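/- For an integer $n \ge 0$ and $t \in \mathbb{R}$ let $$I_n(t) := \frac{1}{2\pi i}\oint_{|z|=1} z^{-n-1}\, e^{\frac{t}{2}(z+z^{-1})}\,\mathrm{d}z$$ be the modified Bessel function of the first kind (the circle is traversed once counterclockwise). Then, for every integer $n \ge 0$ and every real $t \ne 0$, $$|I_n(t)| < \frac{\exp\left(\sqrt{t^2+n^2}\right)\left(\sqrt{(n/t)^2+1}-n/|t|\right)^n}{2\,(n^2+t^2)^{1/4}}.$$ -/

import Mathlib

/-- The modified Bessel function of the first kind `I_n` (`n = 0, 1, 2, …`) at a real argument `t`,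
given by the counterclockwise contour integral over the unit circle
`I_n(t) = (1 / (2 π i)) ∮_{|z| = 1} z ^ (-n - 1) exp ((t / 2) (z + 1 / z)) dz`.
The exponent of `z` is an integer. Twice this number (and the number itself when `n = 0`) is
the `n`-th Chebyshev coefficient of `x ↦ exp (t x)` on `[-1, 1]`. -/
noncomputable def besselI (n : ℕ) (t : ℝ) : ℂ :=
  (2 * (Real.pi : ℂ) * Complex.I)⁻¹ *
    ∮ z in C(0, 1), z ^ (-(n : ℤ) - 1) * Complex.exp (((t : ℂ) / 2) * (z + z⁻¹))

open MeasureTheory Set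

/-! Shift the contour to the circle `|z| = ρ` through the saddle point. Taking absolute values there
bounds `|I_n(t)|` by `ρ⁻ⁿ I_0(R)` with `R = √(t² + n²)`. It remains to show `I_0(s) < exp s / (2
√s)` for `s > 0`: squaring the series `I_0(s) = ∑ (s/2)^(2k) / k!²` and comparing termwise gives
`I_0(s)² ≤ sinh (2s) / (2s) < exp (2s) / (4s)`. -/

/-- The sequence `(2 k + 1) * (binom (2 k) k / 4 ^ k) ^ 2` is bounded by `1`. -/
theorem two_mul_add_one_mul_centralBinom_sq_le (k : ℕ) :
    (2 * k + 1) * Nat.centralBinom k ^ 2 ≤ 16 ^ k := by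
  induction k with
  | zero => simp
  | succ k ih =>
    have h := Nat.succ_mul_centralBinom_succ k
    have key : (k + 1) ^ 2 * ((2 * (k + 1) + 1) * Nat.centralBinom (k + 1) ^ 2) ≤
        (k + 1) ^ 2 * 16 ^ (k + 1) := by
      calc (k + 1) ^ 2 * ((2 * (k + 1) + 1) * Nat.centralBinom (k + 1) ^ 2)
          = (2 * (k + 1) + 1) * ((k + 1) * Nat.centralBinom (k + 1)) ^ 2 := by ring
        _ = 4 * ((2 * k + 3) * (2 * k + 1)) * ((2 * k + 1) * Nat.centralBinom k ^ 2) := by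
          rw [h]; ring
        -- `(2k + 3)(2k + 1) = 4(k + 1)² - 1`.
        _ ≤ 4 * (4 * (k + 1) ^ 2) * 16 ^ k := by
          refine Nat.mul_le_mul (Nat.mul_le_mul_left 4 ?_) ih
          nlinarith
        _ = (k + 1) ^ 2 * 16 ^ (k + 1) := by ring
    exact Nat.le_of_mul_le_mul_left key (by positivity)

theorem prod_odd_div_even (k : ℕ) :
    ∏ i ∈ Finset.range k, (2 * (i : ℝ) + 1) / (2 * i + 2) =
      ((2 * k).factorial : ℝ) / (4 ^ k * (k.factorial : ℝ) ^ 2) := by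
  induction k with
  | zero => simp
  | succ k ih =>
    rw [Finset.prod_range_succ, ih, show 2 * (k + 1) = 2 * k + 1 + 1 by ring,
      Nat.factorial_succ (2 * k + 1), Nat.factorial_succ (2 * k), Nat.factorial_succ k]
    push_cast
    field_simp
    ring

/-- Termwise integration of the cosh series, using Wallis' formula for even powers of sine. -/
theorem hasSum_integral_cosh_mul_sin (s : ℝ) :
    HasSum (fun k : ℕ => Real.pi * ((s / 2) ^ (2 * k) / (k.factorial : ℝ) ^ 2))
      (∫ θ in (0 : ℝ)..Real.pi, Real.cosh (s * Real.sin θ)) := by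
  have hterm (k : ℕ) : Real.pi * ((s / 2) ^ (2 * k) / (k.factorial : ℝ) ^ 2) =
      ∫ θ in (0 : ℝ)..Real.pi, (s * Real.sin θ) ^ (2 * k) / ((2 * k).factorial : ℝ) := by
    simp only [mul_pow]
    rw [intervalIntegral.integral_div, intervalIntegral.integral_const_mul,
      integral_sin_pow_even, prod_odd_div_even, div_pow, pow_mul 2]
    field_simp
    norm_num
  simp_rw [hterm]
  exact intervalIntegral.hasSum_integral_of_dominated_convergence
    (μ := volume) (a := 0) (b := Real.pi)
    (F := fun (k : ℕ) θ => (s * Real.sin θ) ^ (2 * k) / ((2 * k).factorial : ℝ))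
    (f := fun θ => Real.cosh (s * Real.sin θ))
    (fun (k : ℕ) _ => s ^ (2 * k) / ((2 * k).factorial : ℝ))
    (fun k => by fun_prop)
    (fun k => Filter.Eventually.of_forall fun θ _ => by
      rw [Real.norm_of_nonneg (by rw [pow_mul]; positivity)]
      refine div_le_div_of_nonneg_right ?_ (Nat.cast_nonneg _)
      rw [mul_pow]
      refine mul_le_of_le_one_right (by rw [pow_mul]; positivity) ?_
      rw [pow_mul]
      exact pow_le_one₀ (sq_nonneg _) (Real.sin_sq_le_one θ))
    (Filter.Eventually.of_forall fun θ _ => (Real.hasSum_cosh s).summable)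
    (by simp)
    (Filter.Eventually.of_forall fun θ _ => Real.hasSum_cosh _)

/-- A quarter-period shift turns cosine into sine; sine changes sign between the two half-periods,
so the exponentials pair into `2 cosh`. -/
theorem integral_exp_mul_cos_eq (s : ℝ) :
    ∫ θ in (0 : ℝ)..2 * Real.pi, Real.exp (s * Real.cos θ) =
      2 * ∫ θ in (0 : ℝ)..Real.pi, Real.cosh (s * Real.sin θ) := by
  have hc : Continuous fun θ : ℝ => Real.exp (s * Real.sin θ) := by fun_prop
  have hc' : Continuous fun θ : ℝ => Real.exp (-(s * Real.sin θ)) := by fun_prop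
  have hper : Function.Periodic (fun θ : ℝ => Real.exp (s * Real.sin θ)) (2 * Real.pi) :=
    fun θ => by simp
  have h1 : ∫ θ in (0 : ℝ)..2 * Real.pi, Real.exp (s * Real.cos θ) =
      ∫ θ in (0 : ℝ)..2 * Real.pi, Real.exp (s * Real.sin θ) := by
    simp_rw [← Real.sin_add_pi_div_two]
    rw [intervalIntegral.integral_comp_add_right (fun θ => Real.exp (s * Real.sin θ))]
    have := hper.intervalIntegral_add_eq (0 + Real.pi / 2) 0
    rw [zero_add (2 * Real.pi)] at this
    rw [← this]
    congr 1
    ring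
  have h2 : ∫ θ in Real.pi..2 * Real.pi, Real.exp (s * Real.sin θ) =
      ∫ θ in (0 : ℝ)..Real.pi, Real.exp (-(s * Real.sin θ)) := by
    have := intervalIntegral.integral_comp_add_right (a := 0) (b := Real.pi)
      (fun θ => Real.exp (s * Real.sin θ)) Real.pi
    rw [zero_add, ← two_mul] at this
    rw [← this]
    simp [Real.sin_add_pi]
  rw [h1, ← intervalIntegral.integral_add_adjacent_intervals (b := Real.pi)
    (hc.intervalIntegrable _ _) (hc.intervalIntegrable _ _), h2,
    ← intervalIntegral.integral_add (hc.intervalIntegrable _ _) (hc'.intervalIntegrable _ _),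
    ← intervalIntegral.integral_const_mul]
  simp_rw [Real.cosh_eq, mul_div_cancel₀ _ (two_ne_zero' ℝ)]

theorem integral_exp_mul_cos_neg (s : ℝ) :
    ∫ θ in (0 : ℝ)..2 * Real.pi, Real.exp (-s * Real.cos θ) =
      ∫ θ in (0 : ℝ)..2 * Real.pi, Real.exp (s * Real.cos θ) := by
  simp only [integral_exp_mul_cos_eq]
  simp only [neg_mul, Real.cosh_neg]

/-- Cauchy product coefficient of `I_0(s)²`, via `∑ (k choose i)² = (2k choose k)`. -/
theorem sum_range_inv_factorial_sq_mul (s : ℝ) (k : ℕ) :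
    ∑ i ∈ Finset.range (k + 1), (s / 2) ^ (2 * i) / (i.factorial : ℝ) ^ 2 *
        ((s / 2) ^ (2 * (k - i)) / ((k - i).factorial : ℝ) ^ 2) =
      (s / 2) ^ (2 * k) * Nat.centralBinom k / (k.factorial : ℝ) ^ 2 := by
  rw [Nat.centralBinom, ← Nat.sum_range_choose_sq]
  push_cast
  rw [Finset.mul_sum, Finset.sum_div]
  refine Finset.sum_congr rfl fun i hi => ?_
  have hik : i ≤ k := Finset.mem_range_succ_iff.mp hi
  rw [Nat.cast_choose ℝ hik]
  have : (s / 2) ^ (2 * k) = (s / 2) ^ (2 * i) * (s / 2) ^ (2 * (k - i)) := by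
    rw [← pow_add]; congr 1; omega
  rw [this]
  field_simp

/-- Since `(2k)! = (2k choose k) k!²`, this reduces to `(2k + 1) (2k choose k)² ≤ 16^k`. The right
side is the term of `sinh (2s) / (2s)`. -/
theorem sum_range_inv_factorial_sq_mul_le (s : ℝ) (hs : 0 < s) (k : ℕ) :
    (s / 2) ^ (2 * k) * Nat.centralBinom k / (k.factorial : ℝ) ^ 2 ≤
      (2 * s) ^ (2 * k + 1) / ((2 * k + 1).factorial : ℝ) / (2 * s) := by
  have hb : ((2 * k + 1 : ℕ) : ℝ) * (Nat.centralBinom k : ℝ) ^ 2 ≤ 16 ^ k := by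
    exact_mod_cast two_mul_add_one_mul_centralBinom_sq_le k
  have hf : ((2 * k).factorial : ℝ) = Nat.centralBinom k * (k.factorial : ℝ) ^ 2 := by
    have := Nat.choose_mul_factorial_mul_factorial (show k ≤ 2 * k by omega)
    rw [show 2 * k - k = k by omega] at this
    rw [← this, Nat.centralBinom]
    push_cast
    ring
  have hcb : (0 : ℝ) < Nat.centralBinom k := by exact_mod_cast Nat.centralBinom_pos k
  rw [Nat.factorial_succ, Nat.cast_mul, hf, pow_succ (2 * s), div_div,
    div_le_div_iff₀ (by positivity) (by positivity)]
  have h16 : (2 * s) ^ (2 * k) = 16 ^ k * (s / 2) ^ (2 * k) := by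
    rw [pow_mul, pow_mul, ← mul_pow]; congr 1; ring
  rw [h16]
  have := mul_le_mul_of_nonneg_left hb
    (show 0 ≤ (s / 2) ^ (2 * k) * (k.factorial : ℝ) ^ 2 * (2 * s) by positivity)
  calc _ = _ := by ring
    _ ≤ _ := this
    _ = _ := by ring

/-- With `J` the mean of `cosh (s sin θ)` over `[0, π]`, one has `J ^ 2 ≤ sinh (2 s) / (2 s)`,
hence the strict bound `J < exp s / (2 √s)`. -/
theorem integral_exp_mul_cos_lt {s : ℝ} (hs : 0 < s) :
    ∫ θ in (0 : ℝ)..2 * Real.pi, Real.exp (s * Real.cos θ) <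
      2 * Real.pi * (Real.exp s / (2 * Real.sqrt s)) := by
  have hJ := (hasSum_integral_cosh_mul_sin s).div_const Real.pi
  simp_rw [mul_div_cancel_left₀ _ Real.pi_ne_zero] at hJ
  set J := (∫ θ in (0 : ℝ)..Real.pi, Real.cosh (s * Real.sin θ)) / Real.pi with hJdef
  have hn : Summable fun k : ℕ => ‖(s / 2) ^ (2 * k) / (k.factorial : ℝ) ^ 2‖ := by
    refine hJ.summable.congr fun k => (Real.norm_of_nonneg ?_).symm
    positivity
  have hmul := hasSum_sum_range_mul_of_summable_norm hn hn
  rw [hJ.tsum_eq] at hmul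
  simp_rw [sum_range_inv_factorial_sq_mul] at hmul
  have hle : J * J ≤ Real.sinh (2 * s) / (2 * s) :=
    hasSum_le (sum_range_inv_factorial_sq_mul_le s hs) hmul
      ((Real.hasSum_sinh (2 * s)).div_const (2 * s))
  have hlt : J < Real.exp s / (2 * Real.sqrt s) := by
    refine lt_of_pow_lt_pow_left₀ 2 (by positivity) ?_
    rw [sq, div_pow, mul_pow, Real.sq_sqrt hs.le, ← Real.exp_nat_mul]
    refine hle.trans_lt ?_
    rw [Real.sinh_eq, div_div, div_lt_div_iff₀ (by positivity) (by positivity)]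
    -- Strictness comes from the discarded term `exp (-2s)` of sinh.
    have := Real.exp_pos (-(2 * s))
    push_cast
    nlinarith
  rw [integral_exp_mul_cos_eq, mul_assoc]
  rw [hJdef, div_lt_iff₀ Real.pi_pos] at hlt
  linarith

theorem besselI_eq_circleIntegral (n : ℕ) (t : ℝ) {ρ : ℝ} (hρ : 1 ≤ ρ) :
    besselI n t = (2 * (Real.pi : ℂ) * Complex.I)⁻¹ *
      ∮ z in C(0, ρ), z ^ (-(n : ℤ) - 1) * Complex.exp (((t : ℂ) / 2) * (z + z⁻¹)) := by
  have hd : ∀ z : ℂ, z ≠ 0 → DifferentiableAt ℂ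
      (fun z => z ^ (-(n : ℤ) - 1) * Complex.exp (((t : ℂ) / 2) * (z + z⁻¹))) z := fun z hz =>
    (differentiableAt_zpow.2 (Or.inl hz)).mul
      (((differentiableAt_id.add (differentiableAt_inv hz)).const_mul _).cexp)
  rw [besselI, Complex.circleIntegral_eq_of_differentiable_on_annulus_off_countable one_pos hρ
    countable_empty (fun z hz => (hd z ?_).continuousAt.continuousWithinAt)
    (fun z hz => hd z ?_)]
  · rintro rfl
    simp at hz
  · rintro rfl
    simp at hz

theorem re_circleMap_add_inv (ρ t θ : ℝ) :
    (((t : ℂ) / 2) * (circleMap 0 ρ θ + (circleMap 0 ρ θ)⁻¹)).re =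
      t / 2 * (ρ + ρ⁻¹) * Real.cos θ := by
  have h : (circleMap 0 ρ θ)⁻¹ = circleMap 0 ρ⁻¹ (-θ) := by
    rw [circleMap_zero_inv]
  rw [h, show ((t : ℂ) / 2) = ((t / 2 : ℝ) : ℂ) by push_cast; rfl, Complex.re_ofReal_mul]
  simp only [circleMap, Complex.add_re, Complex.zero_re, Complex.re_ofReal_mul,
    Complex.exp_ofReal_mul_I_re, Real.cos_neg]
  ring

theorem norm_besselI_le (n : ℕ) (t : ℝ) {ρ : ℝ} (hρ : 1 ≤ ρ) :
    ‖besselI n t‖ ≤ (2 * Real.pi)⁻¹ * ((ρ ^ n)⁻¹ *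
      ∫ θ in (0 : ℝ)..2 * Real.pi, Real.exp (t / 2 * (ρ + ρ⁻¹) * Real.cos θ)) := by
  have hρ0 : 0 < ρ := one_pos.trans_le hρ
  rw [besselI_eq_circleIntegral n t hρ, norm_mul]
  have h1 : ‖(2 * (Real.pi : ℂ) * Complex.I)⁻¹‖ = (2 * Real.pi)⁻¹ := by
    simp [abs_of_pos Real.pi_pos]
  rw [h1, ← intervalIntegral.integral_const_mul]
  gcongr
  refine (intervalIntegral.norm_integral_le_integral_norm Real.two_pi_pos.le).trans_eq ?_
  refine intervalIntegral.integral_congr fun θ _ => ?_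
  have h2 : ‖circleMap 0 ρ θ‖ = ρ := by rw [norm_circleMap_zero, abs_of_pos hρ0]
  simp only [deriv_circleMap, smul_eq_mul, norm_mul, Complex.norm_I, norm_zpow, h2,
    Complex.norm_exp, re_circleMap_add_inv]
  rw [mul_one, ← mul_assoc, ← zpow_one_add₀ hρ0.ne', show (1 : ℤ) + (-(n : ℤ) - 1) = -n by ring,
    zpow_neg, zpow_natCast]

theorem lemma3p2 (n : ℕ) (t : ℝ) (ht : t ≠ 0) :
    ‖besselI n t‖ <
      Real.exp (Real.sqrt (t ^ 2 + (n : ℝ) ^ 2)) *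
          (Real.sqrt (((n : ℝ) / t) ^ 2 + 1) - (n : ℝ) / |t|) ^ n /
        (2 * ((n : ℝ) ^ 2 + t ^ 2) ^ ((1 : ℝ) / 4)) := by
  have htp : 0 < |t| := abs_pos.2 ht
  have ht2 : 0 < t ^ 2 := by positivity
  set R := Real.sqrt (t ^ 2 + (n : ℝ) ^ 2) with hR
  have hRpos : 0 < R := Real.sqrt_pos.2 (by positivity)
  have hRsq : R ^ 2 = |t| ^ 2 + (n : ℝ) ^ 2 := by
    rw [sq_abs]; exact Real.sq_sqrt (by positivity)
  have hn : (0 : ℝ) ≤ n := n.cast_nonneg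
  have htR : |t| ≤ R := by nlinarith
  -- The positive root of `|t|ρ² - 2nρ - |t| = 0`, which minimizes `ρ⁻ⁿ exp (|t| (ρ + ρ⁻¹) / 2)`.
  set ρ := (n + R) / |t| with hρdef
  have hρ : 1 ≤ ρ := by rw [hρdef, one_le_div htp]; linarith
  have hρinv : ρ⁻¹ = (R - n) / |t| := by
    rw [hρdef, inv_div, div_eq_div_iff (by positivity) htp.ne']
    nlinarith
  have hsaddle : |t| / 2 * (ρ + ρ⁻¹) = R := by
    rw [hρinv, hρdef]; field_simp; ring
  have hbase : Real.sqrt (((n : ℝ) / t) ^ 2 + 1) - (n : ℝ) / |t| = ρ⁻¹ := by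
    have : ((n : ℝ) / t) ^ 2 + 1 = (R / |t|) ^ 2 := by
      rw [div_pow, div_pow, hRsq, sq_abs]; field_simp; ring
    rw [this, Real.sqrt_sq (by positivity), hρinv, sub_div]
  have hden : ((n : ℝ) ^ 2 + t ^ 2) ^ ((1 : ℝ) / 4) = Real.sqrt R := by
    rw [hR, Real.sqrt_eq_rpow, Real.sqrt_eq_rpow, ← Real.rpow_mul (by positivity), add_comm]
    norm_num
  have hint : ∫ θ in (0 : ℝ)..2 * Real.pi, Real.exp (t / 2 * (ρ + ρ⁻¹) * Real.cos θ) =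
      ∫ θ in (0 : ℝ)..2 * Real.pi, Real.exp (R * Real.cos θ) := by
    rcases abs_choice t with h | h
    · rw [← hsaddle, h]
    · rw [← integral_exp_mul_cos_neg, ← hsaddle, h]
      congr! 4
      ring
  have hρn : 0 < (ρ ^ n)⁻¹ := by positivity
  rw [hbase, hden, inv_pow]
  calc ‖besselI n t‖ ≤ _ := norm_besselI_le n t hρ
    _ < (2 * Real.pi)⁻¹ * ((ρ ^ n)⁻¹ * (2 * Real.pi * (Real.exp R / (2 * Real.sqrt R)))) := by
      rw [hint]
      gcongr
      exact integral_exp_mul_cos_lt hRpos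
    _ = _ := by
      have := Real.pi_pos
      field_simp
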